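/- Let $\mathcal X$ be a set, $n,d\ge 1$, $\rho,\beta,L_0,L_1>0$ with $\beta<n\sqrt\rho$, and let $f:\mathbb R^d\times\mathcal X\to\mathbb R$ be such that $f(\cdot;x)$ is $L_0$-Lipschitz (Euclidean norm) for every $x\in\mathcal X$; put $\nabla f(w;x)=0$ at points $w$ where $f(\cdot;x)$ is not differentiable. For a dataset $S=(x_1,\dots,x_n)\in\mathcal X^n$ and a starting point $w_0\in\mathbb R^d$, Adaptive Noisy Gradient Descent is the following procedure. Let $\ell=\log(n\sqrt\rho/\beta)$, $\eta=\frac1{2L_1}$, $\hat\sigma=\frac{L_0}{\sqrt n\,\rho^{1/4}}$ and $g_t=\frac1n\sum_{i=1}^n\nabla f(w_t;x_i)$. Starting with $t=0$, while $\sum_{j<t}\rho_j\le\frac\rho2$, do: 1. form a noisy gradient norm $N_t$ (see below) from fresh noise $\hat b_t$; 2. set $\sigma_t=\max\Big\{\frac{|N_t|}{\sqrt{d\,\ell}},\frac{2L_0}{n\sqrt\rho}\Big\}$, draw fresh noise $b_t\sim\mathcal N(0,\sigma_t^2\mathbb I_d)$, and set $w_{t+1}=w_t-\eta\,(g_t+b_t)$;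 3. set $\rho_t=\min\Big\{\frac{L_0^2\,d\,\ell}{n^2N_t^2},\frac\rho2\Big\}+\frac{\sqrt\rho}{n}$ (the first entry is $+\infty$ if $N_t=0$) and increase $t$ by one. Let $T+1$ be the highest value reached by $t$. The noisy gradient norm is formed in one of two ways: (a) with scalar noise, $N_t=\|g_t\|+\hat b_t$, $\hat b_t\sim\mathcal N(0,\hat\sigma^2)$; or (b) with vector noise, $N_t=\|g_t+\hat b_t\|$, $\hat b_t\sim\mathcal N(0,\hat\sigma^2\mathbb I_d)$. **Theorem.** In each of the variants (a) and (b), for every $w_0$, releasing the sequence $w_0,\dots,w_T$ (of random length) is $\rho$-zCDP: if $\mathcal A(S)$ denotes the law of the released sequence, then for all $S,S'\in\mathcal X^n$ that differ in one data point and all $\alpha\in(1,\infty)$, $$D_\alpha\big(\mathcal A(S)\,\|\,\mathcal A(S')\big)\le\rho\,\alpha,$$ where $D_\alpha(P\|Q)=\frac1{\alpha-1}\log\int\big(\tfrac{dP}{dQ}\big)^\alpha dQ$ if $P\ll Q$, and $D_\alpha(P\|Q)=\infty$ otherwise, is the $\alpha$-Rényi divergence. -/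

import Mathlib

open MeasureTheory ProbabilityTheory
open scoped ENNReal NNReal

noncomputable section

namespace PrivateGD

/-- The `α`-Rényi divergence `D_α(P‖Q) = (α - 1)⁻¹ log ∫ (dP/dQ)^α dQ` for `α > 1`, with value `⊤`
when `P` is not absolutely continuous with respect to `Q`. -/
def renyiDiv {O : Type*} [MeasurableSpace O] (α : ℝ) (P Q : Measure O) : EReal :=
  open Classical in
  if P ≪ Q then (((α - 1)⁻¹ : ℝ) : EReal) * ENNReal.log (∫⁻ y, (P.rnDeriv Q y) ^ α ∂Q) else ⊤

/-- Two datasets of `n` points differ in (at most) one data point. -/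
def Neighbors {X : Type*} {n : ℕ} (S S' : Fin n → X) : Prop :=
  ∃ i, ∀ j, j ≠ i → S j = S' j

/-- `ρ`-zero-concentrated differential privacy of a randomized algorithm, given by the law `M S` of
its output on the dataset `S`. The first clause says that `M S` really is a law. -/
def IsZCDP {X O : Type*} {n : ℕ} [MeasurableSpace O] (ρ : ℝ) (M : (Fin n → X) → Measure O) :
    Prop :=
  (∀ S, IsProbabilityMeasure (M S)) ∧
    ∀ S S', Neighbors S S' → ∀ α : ℝ, 1 < α → renyiDiv α (M S) (M S') ≤ ((ρ * α : ℝ) : EReal)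

/-- `ℝ^d` with the Euclidean norm. -/
abbrev Vec (d : ℕ) := EuclideanSpace ℝ (Fin d)

/-- Gradient of the empirical risk, `(1/n) ∑ᵢ ∇f(w; xᵢ)`. -/
def empGrad {X : Type*} {n d : ℕ} (f : Vec d → X → ℝ) (S : Fin n → X) (w : Vec d) : Vec d :=
  (1 / (n : ℝ)) • ∑ i, gradient (fun v => f v (S i)) w

/-- The numerical inputs of the algorithm: privacy parameter, probability, Lipschitz parameter and
smoothness parameter. -/
structure Params where
  ρ : ℝ
  β : ℝ
  lip : ℝ
  smooth : ℝ

namespace Params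

/-- `log (n √ρ / β)`. -/
def logTerm (p : Params) (n : ℕ) : ℝ := Real.log (n * √p.ρ / p.β)

/-- Step size `η = 1 / (2 L₁)`. -/
def stepSize (p : Params) : ℝ := 1 / (2 * p.smooth)

/-- Scale `σ̂ = L₀ / (√n ρ^{1/4})` of the noise in the estimate of the gradient norm. -/
def normScale (p : Params) (n : ℕ) : ℝ := p.lip / (√(n : ℝ) * p.ρ ^ (1 / 4 : ℝ))

/-- Scale `σ_t` of the gradient noise, as a function of the noisy norm `N = N_t`. -/
def gradScale (p : Params) (n d : ℕ) (N : ℝ) : ℝ :=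
  max (|N| / √(d * p.logTerm n)) (2 * p.lip / (n * √p.ρ))

/-- Privacy budget `ρ_t = min {L₀² d log(n√ρ/β) / (n² N²), ρ/2} + √ρ/n`, as a function of the noisy
norm `N = N_t`; at `N = 0` the first entry of the minimum is `+∞`. -/
def budget (p : Params) (n d : ℕ) (N : ℝ) : ℝ :=
  (if N = 0 then p.ρ / 2
    else min (p.lip ^ 2 * d * p.logTerm n / ((n : ℝ) ^ 2 * N ^ 2)) (p.ρ / 2)) + √p.ρ / n

end Params

section Algorithm

variable {X A : Type*} {n d : ℕ}

/-- The iterates `w_t`. Here `normEst g a` is the noisy estimate of `‖g‖` obtained from the noise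
sample `a`; `(ω t).1` is the noise sample used for `N_t`, and `(ω t).2` is the standard Gaussian
vector which, scaled by `σ_t`, gives `b_t`. -/
def iterate (p : Params) (normEst : Vec d → A → ℝ) (f : Vec d → X → ℝ) (w₀ : Vec d)
    (S : Fin n → X) (ω : ℕ → A × Vec d) : ℕ → Vec d
  | 0 => w₀
  | t + 1 =>
    let w := iterate p normEst f w₀ S ω t
    let g := empGrad f S w
    let N := normEst g (ω t).1
    w - p.stepSize • (g + p.gradScale n d N • (ω t).2)

/-- The noisy gradient norm `N_t`. -/
def noisyNorm (p : Params) (normEst : Vec d → A → ℝ) (f : Vec d → X → ℝ) (w₀ : Vec d)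
    (S : Fin n → X) (ω : ℕ → A × Vec d) (t : ℕ) : ℝ :=
  normEst (empGrad f S (iterate p normEst f w₀ S ω t)) (ω t).1

/-- The total budget `∑_{j < t} ρ_j` spent when the loop condition is checked at time `t`. -/
def spent (p : Params) (normEst : Vec d → A → ℝ) (f : Vec d → X → ℝ) (w₀ : Vec d)
    (S : Fin n → X) (ω : ℕ → A × Vec d) (t : ℕ) : ℝ :=
  ∑ j ∈ Finset.range t, p.budget n d (noisyNorm p normEst f w₀ S ω j)

/-- The index `T`: the loop condition `spent t ≤ ρ/2` first fails at `t = T + 1`. (It holds at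
`t = 0`, and it eventually fails by `exists_spent_gt`.) -/
def lastIndex (p : Params) (normEst : Vec d → A → ℝ) (f : Vec d → X → ℝ) (w₀ : Vec d)
    (S : Fin n → X) (ω : ℕ → A × Vec d) : ℕ :=
  sInf {T | p.ρ / 2 < spent p normEst f w₀ S ω (T + 1)}

theorem exists_spent_gt (p : Params) (hn : 0 < n) (hρ : 0 < p.ρ) (hlog : 0 ≤ p.logTerm n)
    (normEst : Vec d → A → ℝ) (f : Vec d → X → ℝ) (w₀ : Vec d)
    (S : Fin n → X) (ω : ℕ → A × Vec d) :
    {T | p.ρ / 2 < spent p normEst f w₀ S ω (T + 1)}.Nonempty := by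
  have hs : 0 < √p.ρ / n := by positivity
  have hb : ∀ N, √p.ρ / n ≤ p.budget n d N := by
    intro N
    have : 0 ≤ (if N = 0 then p.ρ / 2
        else min (p.lip ^ 2 * d * p.logTerm n / ((n : ℝ) ^ 2 * N ^ 2)) (p.ρ / 2)) := by
      split_ifs <;> positivity
    unfold Params.budget
    linarith
  obtain ⟨k, hk⟩ := exists_nat_gt (p.ρ / 2 / (√p.ρ / n))
  refine ⟨k, ?_⟩
  have h1 : (Finset.range (k + 1)).card • (√p.ρ / n) ≤ spent p normEst f w₀ S ω (k + 1) :=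
    Finset.card_nsmul_le_sum _ _ _ fun j _ => hb _
  rw [Finset.card_range, nsmul_eq_mul] at h1
  rw [div_lt_iff₀ hs] at hk
  push_cast at h1
  show p.ρ / 2 < _
  linarith

/-- The released sequence `(w_0, …, w_T)`, of random length. -/
def output (p : Params) (normEst : Vec d → A → ℝ) (f : Vec d → X → ℝ) (w₀ : Vec d)
    (S : Fin n → X) (ω : ℕ → A × Vec d) : Σ T : ℕ, (Fin (T + 1) → Vec d) :=
  ⟨lastIndex p normEst f w₀ S ω, fun i => iterate p normEst f w₀ S ω i⟩

/-- Law of the released sequence, when the noise samples of all steps are independent, those for the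
gradient norms having law `ν` and those for the gradients being standard Gaussian. -/
def outputLaw [MeasurableSpace A] (p : Params) (normEst : Vec d → A → ℝ) (ν : Measure A)
    (f : Vec d → X → ℝ) (w₀ : Vec d) (S : Fin n → X) :
    Measure (Σ T : ℕ, (Fin (T + 1) → Vec d)) :=
  (Measure.infinitePi fun _ : ℕ => ν.prod (stdGaussian (Vec d))).map
    (output p normEst f w₀ S)

/-- Adaptive noisy gradient descent with scalar noise added to the gradient norm:
`N_t = ‖∇F(w_t; S)‖ + b̂_t`, `b̂_t ∼ N(0, σ̂²)`. -/
def adaptiveGDScalar (p : Params) (f : Vec d → X → ℝ) (w₀ : Vec d) (S : Fin n → X) :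
    Measure (Σ T : ℕ, (Fin (T + 1) → Vec d)) :=
  outputLaw p (fun g (z : ℝ) => ‖g‖ + p.normScale n * z) (gaussianReal 0 1) f w₀ S

/-- Adaptive noisy gradient descent with Gaussian vector noise inside the gradient norm:
`N_t = ‖∇F(w_t; S) + b̂_t‖`, `b̂_t ∼ N(0, σ̂² I_d)`. -/
def adaptiveGDVector (p : Params) (f : Vec d → X → ℝ) (w₀ : Vec d) (S : Fin n → X) :
    Measure (Σ T : ℕ, (Fin (T + 1) → Vec d)) :=
  outputLaw p (fun g (z : Vec d) => ‖g + p.normScale n • z‖) (stdGaussian (Vec d)) f w₀ S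

end Algorithm

end PrivateGD

end

/-! Call ε the cost of a Rényi bound D_α ≤ εα. Changing one data point moves the gradient `g_t` by
at most 2L₀/n, and translating a Gaussian of scale σ by v costs ‖v‖²/(2σ²). Hence `N_t` costs at
most 2√ρ/n and, given `N_t`, the gradient step costs at most 2(ρ_t - √ρ/n), so a complete iteration
costs at most 2ρ_t. The stopping rule keeps ∑_{t<T} ρ_t ≤ ρ/2. The last iteration may overshoot this
budget, but its new point is not released: it acts only through the decision to stop. If the
remaining budget is at most √ρ/n, that decision is certain, because every ρ_t exceeds √ρ/n;
otherwise the remaining budget pays for the norm.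

The costs are adaptive and the number of steps is random, so the composition is an induction on the
remaining budget r, with cost 2r (`value_le`). It uses the Hölder-dual form `DualBound` of a Rényi
bound, a statement about integrals of test functions: it passes through iterated integrals without
any density for the law of the output. `lintegral_infinitePi_natCons` separates the first iteration
from the later ones, `dualBound_scalarNorm`, `dualBound_vectorNorm` and `dualBound_gradStep` bound
the single costs, and `DualBound.renyiDiv_le` returns to the divergence. -/

noncomputable section

namespace PrivateGD

/-! ### Rényi bounds in dual form -/

/-- The dual form of the Rényi bound `D_α(P‖Q) ≤ ε α`, where `q` is the exponent conjugate
to `α`. -/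
def DualBound {O : Type*} [MeasurableSpace O] (α q ε : ℝ) (P Q : Measure O) : Prop :=
  ∀ u : O → ℝ≥0∞, Measurable u →
    ∫⁻ x, u x ∂P ≤ ENNReal.ofReal (Real.exp ((α - 1) * ε)) * (∫⁻ x, u x ^ q ∂Q) ^ (1 / q)

theorem DualBound.absolutelyContinuous {O : Type*} [MeasurableSpace O] {α q ε : ℝ}
    {P Q : Measure O} (hq : 0 < q) (h : DualBound α q ε P Q) : P ≪ Q := by
  refine Measure.AbsolutelyContinuous.mk fun s hs hQ => ?_
  have h1 := h (s.indicator 1) (measurable_one.indicator hs)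
  have h2 : (fun x => (s.indicator (1 : O → ℝ≥0∞) x) ^ q) = s.indicator 1 := by
    ext x
    by_cases hx : x ∈ s <;> simp [hx, hq]
  rw [h2, lintegral_indicator_one hs, lintegral_indicator_one hs, hQ,
    ENNReal.zero_rpow_of_pos (by positivity), mul_zero] at h1
  exact le_antisymm h1 zero_le

theorem ENNReal.le_rpow_of_le_mul_rpow {α q : ℝ} (hα : α.HolderConjugate q) {a c : ℝ≥0∞}
    (ha : a ≠ ⊤) (h : a ≤ c * a ^ (1 / q)) : a ≤ c ^ α := by
  rcases eq_or_ne a 0 with rfl | h0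
  · exact zero_le
  have h1 : a ^ (1 / α) * a ^ (1 / q) ≤ c * a ^ (1 / q) := by
    rw [← ENNReal.rpow_add _ _ h0 ha, one_div, one_div, hα.inv_add_inv_eq_one, ENNReal.rpow_one]
    simpa using h
  have h2 : a ^ (1 / q) ≠ 0 := by simp [ENNReal.rpow_eq_zero_iff, h0, ha]
  have h3 : a ^ (1 / q) ≠ ⊤ := by simp [ENNReal.rpow_eq_top_iff, h0, ha]
  have h4 : a ^ (1 / α) ≤ c := (ENNReal.mul_le_mul_iff_left h2 h3).1 h1
  have h5 := ENNReal.rpow_le_rpow h4 hα.nonneg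
  rwa [← ENNReal.rpow_mul, one_div, inv_mul_cancel₀ hα.ne_zero, ENNReal.rpow_one] at h5

/-- Testing with u = D^(α-1), D = dP/dQ, gives I ≤ c I^(1/q) for I = ∫ D^α dQ, because (α-1)q = α.
Cancelling I^(1/q) requires I < ∞, so D is first truncated at m, and then m → ∞ by monotone
convergence. -/
theorem DualBound.lintegral_rnDeriv_rpow_le {O : Type*} [MeasurableSpace O] {α q ε : ℝ}
    {P Q : Measure O} [IsProbabilityMeasure P] [IsProbabilityMeasure Q]
    (hα : α.HolderConjugate q) (h : DualBound α q ε P Q) :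
    ∫⁻ y, (P.rnDeriv Q y) ^ α ∂Q ≤ ENNReal.ofReal (Real.exp ((α - 1) * ε)) ^ α := by
  have hac := h.absolutelyContinuous hα.symm.pos
  set D := P.rnDeriv Q with hD
  have hDm : Measurable D := Measure.measurable_rnDeriv P Q
  have hα1 : 0 < α - 1 := sub_pos.2 hα.lt
  have hm : ∀ m : ℕ, Measurable fun y => min (D y) m := fun m => hDm.min measurable_const
  have hlim : Filter.Tendsto (fun m : ℕ => ∫⁻ y, (min (D y) m) ^ α ∂Q) Filter.atTop
      (nhds (∫⁻ y, D y ^ α ∂Q)) := by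
    refine lintegral_tendsto_of_tendsto_of_monotone
      (fun m => ((hm m).pow_const α).aemeasurable) (.of_forall fun y => ?_)
      (.of_forall fun y => ?_)
    · intro m k hmk
      exact ENNReal.rpow_le_rpow (min_le_min le_rfl (by exact_mod_cast hmk)) hα.nonneg
    · refine (ENNReal.continuous_rpow_const (y := α)).continuousAt.tendsto.comp ?_
      simpa using (tendsto_const_nhds (x := D y)).min ENNReal.tendsto_nat_nhds_top
  refine le_of_tendsto' hlim fun m => ?_
  have hfin : ∫⁻ y, (min (D y) m) ^ α ∂Q ≠ ⊤ := by
    refine ((lintegral_mono fun y => ENNReal.rpow_le_rpow (min_le_right (D y) (m : ℝ≥0∞))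
      hα.nonneg).trans_lt ?_).ne
    rw [lintegral_const, measure_univ, mul_one]
    exact ENNReal.rpow_lt_top_of_nonneg hα.nonneg (by simp)
  refine ENNReal.le_rpow_of_le_mul_rpow hα hfin ?_
  have h1 := h (fun y => (min (D y) m) ^ (α - 1)) ((hm m).pow_const _)
  have h2 : (fun y => ((min (D y) (m : ℝ≥0∞)) ^ (α - 1)) ^ q) = fun y => (min (D y) m) ^ α := by
    ext y
    rw [← ENNReal.rpow_mul, hα.sub_one_mul_conj]
  rw [h2, ← lintegral_rnDeriv_mul hac ((hm m).pow_const _).aemeasurable] at h1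
  -- Only one factor of min(D, m)^α is enlarged to D; the other α - 1 stay truncated and form the
  -- test function.
  refine le_trans (lintegral_mono fun y => ?_) h1
  calc (min (D y) m) ^ α = min (D y) m * (min (D y) m) ^ (α - 1) := by
        conv_lhs => rw [show α = 1 + (α - 1) by ring]
        rw [ENNReal.rpow_add_of_nonneg _ _ zero_le_one hα1.le, ENNReal.rpow_one]
    _ ≤ _ := by gcongr; exact min_le_left _ _

theorem DualBound.renyiDiv_le {O : Type*} [MeasurableSpace O] {α q ε : ℝ}
    {P Q : Measure O} [IsProbabilityMeasure P] [IsProbabilityMeasure Q]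
    (hα : α.HolderConjugate q) (h : DualBound α q ε P Q) :
    renyiDiv α P Q ≤ ((ε * α : ℝ) : EReal) := by
  have hα1 : 0 < α - 1 := sub_pos.2 hα.lt
  rw [renyiDiv, if_pos (h.absolutelyContinuous hα.symm.pos)]
  have h1 := ENNReal.log_le_log (h.lintegral_rnDeriv_rpow_le hα)
  rw [ENNReal.ofReal_rpow_of_pos (Real.exp_pos _), ← Real.exp_mul,
    ENNReal.log_ofReal_of_pos (Real.exp_pos _), Real.log_exp] at h1
  refine (mul_le_mul_of_nonneg_left h1 (by exact_mod_cast (inv_pos.2 hα1).le)).trans ?_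
  rw [← EReal.coe_mul]
  refine le_of_eq ?_
  congr 1
  field_simp

theorem DualBound.map {O O' : Type*} [MeasurableSpace O] [MeasurableSpace O'] {α q ε : ℝ}
    {P Q : Measure O} (h : DualBound α q ε P Q) {φ : O → O'} (hφ : Measurable φ) :
    DualBound α q ε (P.map φ) (Q.map φ) := by
  intro u hu
  rw [lintegral_map hu hφ, lintegral_map (hu.pow_const q) hφ]
  exact h _ (hu.comp hφ)

theorem DualBound.mono {O : Type*} [MeasurableSpace O] {α q ε ε' : ℝ}
    {P Q : Measure O} (hα : 1 ≤ α) (h : DualBound α q ε P Q) (hε : ε ≤ ε') :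
    DualBound α q ε' P Q := by
  intro u hu
  refine (h u hu).trans ?_
  have : 0 ≤ α - 1 := sub_nonneg.2 hα
  gcongr

/-- This is Hölder's inequality for the product of D and u. -/
theorem DualBound.of_withDensity {O : Type*} [MeasurableSpace O] {α q ε : ℝ}
    (hα : α.HolderConjugate q) {Q : Measure O} {D : O → ℝ≥0∞} (hD : Measurable D)
    (h : ∫⁻ x, D x ^ α ∂Q ≤ ENNReal.ofReal (Real.exp (α * ((α - 1) * ε)))) :
    DualBound α q ε (Q.withDensity D) Q := by
  intro u hu
  rw [lintegral_withDensity_eq_lintegral_mul _ hD hu]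
  refine (ENNReal.lintegral_mul_le_Lp_mul_Lq Q hα hD.aemeasurable hu.aemeasurable).trans ?_
  gcongr
  refine (ENNReal.rpow_le_rpow h (by simpa using hα.nonneg)).trans (le_of_eq ?_)
  rw [ENNReal.ofReal_rpow_of_pos (Real.exp_pos _), ← Real.exp_mul]
  congr 2
  have := hα.ne_zero
  field_simp

/-! ### Cost of translating a Gaussian -/

/-- Density of `N(δ, 1)` with respect to `N(0, 1)`. -/
def shiftDensity (δ x : ℝ) : ℝ≥0∞ := ENNReal.ofReal (Real.exp (δ * x - δ ^ 2 / 2))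

theorem measurable_shiftDensity (δ : ℝ) : Measurable (shiftDensity δ) := by
  unfold shiftDensity; fun_prop

theorem gaussianReal_map_add_eq_withDensity (δ : ℝ) :
    (gaussianReal 0 1).map (· + δ) = (gaussianReal 0 1).withDensity (shiftDensity δ) := by
  rw [gaussianReal_map_add_const, gaussianReal_of_var_ne_zero _ one_ne_zero,
    gaussianReal_of_var_ne_zero _ one_ne_zero,
    ← withDensity_mul _ (measurable_gaussianPDF _ _) (measurable_shiftDensity δ)]
  congr 1
  ext x
  rw [Pi.mul_apply, gaussianPDF, gaussianPDF, shiftDensity,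
    ← ENNReal.ofReal_mul (gaussianPDFReal_nonneg _ _ _), gaussianPDFReal, gaussianPDFReal,
    mul_assoc (Real.sqrt _)⁻¹, ← Real.exp_add]
  congr 3
  push_cast
  ring

/-- The power of the density is an exponential of a linear function, so the Gaussian moment
generating function at αδ gives α²δ²/2 - αδ²/2. -/
theorem lintegral_shiftDensity_rpow (α δ : ℝ) :
    ∫⁻ x, shiftDensity δ x ^ α ∂(gaussianReal 0 1) =
      ENNReal.ofReal (Real.exp (α * ((α - 1) * (δ ^ 2 / 2)))) := by
  have h1 : ∀ x, shiftDensity δ x ^ α =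
      ENNReal.ofReal (Real.exp (-(α * δ ^ 2 / 2)) * Real.exp ((α * δ) * x)) := by
    intro x
    rw [shiftDensity, ENNReal.ofReal_rpow_of_pos (Real.exp_pos _), ← Real.exp_mul, ← Real.exp_add]
    congr 2
    ring
  simp_rw [h1]
  rw [← ofReal_integral_eq_lintegral_ofReal
    ((integrable_exp_mul_gaussianReal _).const_mul _) (.of_forall fun x => by positivity),
    integral_const_mul]
  have h2 := congrFun (mgf_fun_id_gaussianReal (μ := 0) (v := 1)) (α * δ)
  rw [mgf] at h2
  rw [h2, ← Real.exp_add]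
  congr 2
  push_cast
  ring

theorem dualBound_gaussianReal {α q : ℝ} (hα : α.HolderConjugate q) (δ : ℝ) :
    DualBound α q (δ ^ 2 / 2) ((gaussianReal 0 1).map (· + δ)) (gaussianReal 0 1) := by
  rw [gaussianReal_map_add_eq_withDensity]
  exact .of_withDensity hα (measurable_shiftDensity δ) (lintegral_shiftDensity_rpow α δ).le

section Pi

variable {ι : Type*} [Fintype ι]

theorem lintegral_pi_prod {Y : ι → Type*} [∀ i, MeasurableSpace (Y i)]
    (μ : ∀ i, Measure (Y i)) [∀ i, IsProbabilityMeasure (μ i)] {F : ∀ i, Y i → ℝ≥0∞}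
    (hF : ∀ i, Measurable (F i)) :
    ∫⁻ x, ∏ i, F i (x i) ∂(Measure.pi μ) = ∏ i, ∫⁻ y, F i y ∂(μ i) := by
  rw [lintegral_prod_eq_prod_lintegral_of_indepFun Finset.univ (fun i (x : ∀ i, Y i) => F i (x i))
    (iIndepFun_pi fun i => (hF i).aemeasurable) fun i => (hF i).comp (measurable_pi_apply i)]
  refine Finset.prod_congr rfl fun i _ => ?_
  conv_rhs => rw [← (measurePreserving_eval μ i).map_eq]
  rw [lintegral_map (hF i) (measurable_pi_apply i)]

theorem pi_withDensity {Y : ι → Type*} [∀ i, MeasurableSpace (Y i)]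
    (μ : ∀ i, Measure (Y i)) [∀ i, IsProbabilityMeasure (μ i)] {F : ∀ i, Y i → ℝ≥0∞}
    (hF : ∀ i, Measurable (F i)) [∀ i, SigmaFinite ((μ i).withDensity (F i))] :
    Measure.pi (fun i => (μ i).withDensity (F i)) =
      (Measure.pi μ).withDensity fun x => ∏ i, F i (x i) := by
  refine Measure.pi_eq fun s hs => ?_
  rw [withDensity_apply _ (.univ_pi hs), ← lintegral_indicator (.univ_pi hs)]
  have h1 : (Set.pi Set.univ s).indicator (fun x : ∀ i, Y i => ∏ i, F i (x i)) =
      fun x => ∏ i, (s i).indicator (F i) (x i) := by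
    ext x
    by_cases hx : x ∈ Set.pi Set.univ s
    · rw [Set.indicator_of_mem hx]
      exact Finset.prod_congr rfl fun i _ => (Set.indicator_of_mem (hx i trivial) _).symm
    · rw [Set.indicator_of_notMem hx]
      obtain ⟨i, hi⟩ : ∃ i, x i ∉ s i := by simpa [Set.mem_pi] using hx
      exact (Finset.prod_eq_zero (Finset.mem_univ i) (Set.indicator_of_notMem hi _)).symm
  rw [h1, lintegral_pi_prod μ fun i => (hF i).indicator (hs i)]
  refine Finset.prod_congr rfl fun i _ => ?_
  rw [withDensity_apply _ (hs i), lintegral_indicator (hs i)]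

/-- Densities multiply over independent coordinates, so the costs δᵢ²/2 add up. -/
theorem dualBound_pi_gaussianReal {α q : ℝ} (hα : α.HolderConjugate q) (δ : ι → ℝ) :
    DualBound α q ((∑ i, δ i ^ 2) / 2)
      ((Measure.pi fun _ => gaussianReal 0 1).map fun x i => x i + δ i)
      (Measure.pi fun _ : ι => gaussianReal 0 1) := by
  have hm : ∀ i, AEMeasurable (· + δ i) (gaussianReal 0 1) := fun i => by fun_prop
  have hp : ∀ i, IsProbabilityMeasure ((gaussianReal 0 1).map (· + δ i)) := fun i =>
    Measure.isProbabilityMeasure_map (hm i)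
  rw [Measure.pi_map_pi (f := fun i x => x + δ i) hm]
  simp_rw [gaussianReal_map_add_eq_withDensity] at hp ⊢
  rw [pi_withDensity _ fun i => measurable_shiftDensity (δ i)]
  have hD : Measurable fun x : ι → ℝ => ∏ i, shiftDensity (δ i) (x i) :=
    Finset.measurable_prod _ fun i _ => (measurable_shiftDensity _).comp (measurable_pi_apply i)
  refine .of_withDensity hα hD (le_of_eq ?_)
  simp_rw [← ENNReal.prod_rpow_of_nonneg hα.nonneg]
  rw [lintegral_pi_prod _ fun i => (measurable_shiftDensity (δ i)).pow_const α]
  simp_rw [lintegral_shiftDensity_rpow]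
  rw [← ENNReal.ofReal_prod_of_nonneg fun i _ => (Real.exp_pos _).le, ← Real.exp_sum,
    ← Finset.mul_sum, ← Finset.mul_sum, Finset.sum_div]

end Pi

theorem dualBound_stdGaussian {d : ℕ} {α q : ℝ} (hα : α.HolderConjugate q) (δ : Vec d) :
    DualBound α q (‖δ‖ ^ 2 / 2) ((stdGaussian (Vec d)).map (· + δ)) (stdGaussian (Vec d)) := by
  have h := (dualBound_pi_gaussianReal hα fun i => δ i).map
    (φ := WithLp.toLp 2) (by fun_prop)
  rw [map_pi_eq_stdGaussian, Measure.map_map (by fun_prop) (by fun_prop)] at h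
  rw [← map_pi_eq_stdGaussian, Measure.map_map (by fun_prop) (by fun_prop),
    map_pi_eq_stdGaussian, EuclideanSpace.real_norm_sq_eq]
  exact h

/-! ### Splitting an i.i.d. sequence after its first term -/

/-- The sequence with first term `y` followed by `ω`. -/
def natCons {Y : Type*} (y : Y) (ω : ℕ → Y) : ℕ → Y
  | 0 => y
  | t + 1 => ω t

theorem measurable_natCons {Y : Type*} [MeasurableSpace Y] :
    Measurable fun p : Y × (ℕ → Y) => natCons p.1 p.2 := by
  refine measurable_pi_lambda _ fun t => ?_
  cases t with
  | zero => exact measurable_fst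
  | succ t => exact (measurable_pi_apply t).comp measurable_snd

theorem infinitePi_map_natCons {Y : Type*} [MeasurableSpace Y] (κ : Measure Y)
    [IsProbabilityMeasure κ] :
    (κ.prod (Measure.infinitePi fun _ : ℕ => κ)).map (fun p => natCons p.1 p.2) =
      Measure.infinitePi fun _ : ℕ => κ := by
  refine Measure.eq_infinitePi _ fun s t ht => ?_
  classical
  -- Padding with `Set.univ` turns the cylinder over `s` into one over an initial segment, which
  -- splits into coordinate 0 and the shifted coordinates.
  obtain ⟨N, hN⟩ : ∃ N, s ⊆ Finset.range (N + 1) :=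
    ⟨s.sup id, fun i hi => Finset.mem_range_succ_iff.2 (Finset.le_sup (f := id) hi)⟩
  let t' : ℕ → Set Y := fun i => if i ∈ s then t i else Set.univ
  have ht' : ∀ i, MeasurableSet (t' i) := fun i => by
    by_cases hi : i ∈ s <;> simp [t', hi, ht i]
  have h1 : ∏ i ∈ s, κ (t i) = ∏ i ∈ Finset.range (N + 1), κ (t' i) := by
    rw [← Finset.prod_subset hN (f := fun i => κ (t' i)) fun i _ hi => by simp [t', hi]]
    exact Finset.prod_congr rfl fun i hi => by simp [t', hi]
  have h2 : (fun p : Y × (ℕ → Y) => natCons p.1 p.2) ⁻¹' (Set.pi s t) =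
      t' 0 ×ˢ Set.pi (Finset.range N) fun i => t' (i + 1) := by
    ext p
    simp only [Set.mem_preimage, Set.mem_pi, Finset.mem_coe, Set.mem_prod, Finset.mem_range, t']
    constructor
    · intro h
      refine ⟨?_, fun i _ => ?_⟩
      · split_ifs with h0
        · exact h 0 h0
        · trivial
      · split_ifs with hi
        · exact h (i + 1) hi
        · trivial
    · rintro ⟨h0, h⟩ i hi
      cases i with
      | zero => simpa [hi, natCons] using h0
      | succ i =>
        have := h i (by simpa using hN hi)
        simpa [hi, natCons] using this
  rw [Measure.map_apply measurable_natCons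
    (.pi s.countable_toSet fun i _ => ht i), h2, Measure.prod_prod,
    Measure.infinitePi_pi _ fun i _ => ht' (i + 1), h1, Finset.prod_range_succ', mul_comm]

theorem lintegral_infinitePi_natCons {Y : Type*} [MeasurableSpace Y] (κ : Measure Y)
    [IsProbabilityMeasure κ] {F : (ℕ → Y) → ℝ≥0∞} (hF : Measurable F) :
    ∫⁻ ω, F ω ∂(Measure.infinitePi fun _ : ℕ => κ) =
      ∫⁻ y, ∫⁻ ω, F (natCons y ω) ∂(Measure.infinitePi fun _ : ℕ => κ) ∂κ := by
  conv_lhs => rw [← infinitePi_map_natCons κ]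
  rw [lintegral_map hF measurable_natCons,
    lintegral_prod (fun p => F (natCons p.1 p.2)) (hF.comp measurable_natCons).aemeasurable]

/-! ### Trajectories of random length -/

/-- Finite sequences of random length `T + 1`. -/
abbrev Trajectory (d : ℕ) := Σ T : ℕ, (Fin (T + 1) → Vec d)

namespace Trajectory

variable {d : ℕ}

/-- The initial segment `x 0, …, x T`. -/
def ofSeq (x : ℕ → Vec d) (T : ℕ) : Trajectory d := ⟨T, fun i => x i⟩

/-- Prepend a point to a trajectory. -/
def cons (w : Vec d) (o : Trajectory d) : Trajectory d := ⟨o.1 + 1, Fin.cons w o.2⟩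

theorem cons_ofSeq (w : Vec d) (x : ℕ → Vec d) (T : ℕ) :
    cons w (ofSeq x T) = ofSeq (natCons w x) (T + 1) := by
  unfold cons ofSeq
  congr 1
  ext i : 1
  refine Fin.cases ?_ (fun j => ?_) i <;> simp [natCons]

theorem measurable_mk (T : ℕ) :
    Measurable fun v : Fin (T + 1) → Vec d => (⟨T, v⟩ : Trajectory d) :=
  measurable_iff_le_map.2 (iInf_le _ T)

theorem measurable_cons (w : Vec d) : Measurable (cons w) := by
  intro s hs
  refine MeasurableSpace.measurableSet_iInf.2 fun T => ?_
  have h : Measurable fun v : Fin (T + 1) → Vec d => (Fin.cons w v : Fin (T + 1 + 1) → Vec d) := by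
    refine measurable_pi_lambda _ fun i => ?_
    refine Fin.cases ?_ (fun j => ?_) i
    · simp
    · simpa using measurable_pi_apply j
  exact (measurable_mk (T + 1)).comp h hs

theorem measurable_ofSeq {Z : Type*} [MeasurableSpace Z] {x : Z → ℕ → Vec d} {T : Z → ℕ}
    (hx : ∀ t, Measurable fun z => x z t) (hT : Measurable T) :
    Measurable fun z => ofSeq (x z) (T z) := by
  intro s hs
  have h : (fun z => ofSeq (x z) (T z)) ⁻¹' s =
      ⋃ k, T ⁻¹' {k} ∩ (fun z => ofSeq (x z) k) ⁻¹' s := by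
    ext z
    simp
  rw [h]
  refine .iUnion fun k => (hT (measurableSet_singleton k)).inter ?_
  exact (measurable_mk k).comp (measurable_pi_lambda _ fun i => hx i) hs

end Trajectory

/-! ### Recursion in the starting point and the remaining budget -/

section Recursion

variable {X A : Type*} {n d : ℕ}

/-- One gradient step from `w` with gradient `g`, noisy norm `N` and Gaussian sample `z`. -/
def gradStep (p : Params) (n : ℕ) (w g : Vec d) (N : ℝ) (z : Vec d) : Vec d :=
  w - p.stepSize • (g + p.gradScale n d N • z)

/-- The released sequence when the algorithm starts at `w` with remaining budget `r`. -/
def trajectoryFrom (p : Params) (normEst : Vec d → A → ℝ) (f : Vec d → X → ℝ) (S : Fin n → X)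
    (r : ℝ) (w : Vec d) (ω : ℕ → A × Vec d) : Trajectory d :=
  .ofSeq (iterate p normEst f w S ω) (sInf {T | r < spent p normEst f w S ω (T + 1)})

variable (p : Params) (normEst : Vec d → A → ℝ) (f : Vec d → X → ℝ) (S : Fin n → X)

theorem iterate_natCons (w : Vec d) (y : A × Vec d) (ω : ℕ → A × Vec d) (t : ℕ) :
    iterate p normEst f w S (natCons y ω) (t + 1) =
      iterate p normEst f
        (gradStep p n w (empGrad f S w) (normEst (empGrad f S w) y.1) y.2) S ω t := by
  induction t with
  | zero => rfl
  | succ t ih =>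
    rw [iterate, ih]
    rfl

theorem spent_natCons (w : Vec d) (y : A × Vec d) (ω : ℕ → A × Vec d) (t : ℕ) :
    spent p normEst f w S (natCons y ω) (t + 1) =
      spent p normEst f
        (gradStep p n w (empGrad f S w) (normEst (empGrad f S w) y.1) y.2) S ω t +
      p.budget n d (normEst (empGrad f S w) y.1) := by
  rw [spent, Finset.sum_range_succ']
  congr 1
  refine Finset.sum_congr rfl fun j _ => ?_
  rw [noisyNorm, iterate_natCons]
  rfl

theorem Params.lt_budget {p : Params} (hn : 0 < n) (hd : 0 < d) (hρ : 0 < p.ρ)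
    (hlip : 0 < p.lip) (hlog : 0 < p.logTerm n) (N : ℝ) : √p.ρ / n < p.budget n d N := by
  have : 0 < (if N = 0 then p.ρ / 2
      else min (p.lip ^ 2 * d * p.logTerm n / ((n : ℝ) ^ 2 * N ^ 2)) (p.ρ / 2)) := by
    split_ifs <;> positivity
  unfold Params.budget
  linarith

theorem exists_lt_spent {p : Params} (hn : 0 < n) (hρ : 0 < p.ρ)
    (hb : ∀ N, √p.ρ / n < p.budget n d N) (r : ℝ) (w : Vec d) (ω : ℕ → A × Vec d) :
    {T | r < spent p normEst f w S ω (T + 1)}.Nonempty := by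
  have hs : 0 < √p.ρ / n := by positivity
  obtain ⟨k, hk⟩ := exists_nat_gt (r / (√p.ρ / n))
  refine ⟨k, ?_⟩
  have h1 : (Finset.range (k + 1)).card • (√p.ρ / n) ≤ spent p normEst f w S ω (k + 1) :=
    Finset.card_nsmul_le_sum _ _ _ fun j _ => (hb _).le
  rw [Finset.card_range, nsmul_eq_mul] at h1
  rw [div_lt_iff₀ hs] at hk
  push_cast at h1
  show r < _
  linarith

theorem trajectoryFrom_of_lt {r : ℝ} {w : Vec d} {ω : ℕ → A × Vec d}
    (h : r < p.budget n d (normEst (empGrad f S w) (ω 0).1)) :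
    trajectoryFrom p normEst f S r w ω = .ofSeq (fun _ => w) 0 := by
  have h0 : sInf {T | r < spent p normEst f w S ω (T + 1)} = 0 := by
    refine Nat.sInf_eq_zero.2 (.inl ?_)
    simpa [spent, noisyNorm, iterate] using h
  rw [trajectoryFrom, h0]
  unfold Trajectory.ofSeq
  congr 1
  ext i : 1
  rw [Fin.fin_one_eq_zero i]
  rfl

/-- When the first iteration fits in the budget, the remaining ones are a run of the same algorithm
from the new point with the budget reduced. -/
theorem trajectoryFrom_natCons_of_le {p : Params} (hn : 0 < n) (hρ : 0 < p.ρ)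
    (hb : ∀ N, √p.ρ / n < p.budget n d N) {r : ℝ} {w : Vec d} {y : A × Vec d}
    {ω : ℕ → A × Vec d} (h : p.budget n d (normEst (empGrad f S w) y.1) ≤ r) :
    trajectoryFrom p normEst f S r w (natCons y ω) =
      .cons w (trajectoryFrom p normEst f S (r - p.budget n d (normEst (empGrad f S w) y.1))
        (gradStep p n w (empGrad f S w) (normEst (empGrad f S w) y.1) y.2) ω) := by
  have hpos : 1 ≤ sInf {T | r < spent p normEst f w S (natCons y ω) (T + 1)} := by
    rw [Nat.one_le_iff_ne_zero, Ne, Nat.sInf_eq_zero, not_or]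
    -- `sInf ∅ = 0`, so a positive stopping index also requires that the loop does stop.
    refine ⟨?_, (exists_lt_spent normEst f S hn hρ hb r w _).ne_empty⟩
    simpa [spent, noisyNorm, iterate, natCons] using h
  rw [trajectoryFrom, trajectoryFrom, Trajectory.cons_ofSeq, ← Nat.sInf_add hpos]
  congr 1
  · ext t : 1
    cases t with
    | zero => rfl
    | succ t => exact iterate_natCons ..
  · congr 2
    ext T
    simp only [Set.mem_ofPred_eq]
    rw [spent_natCons, sub_lt_iff_lt_add]

end Recursion

/-! ### Measurability of the algorithm -/

section Measurability

variable {X A : Type*} [MeasurableSpace A] {n d : ℕ}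

theorem measurable_empGrad (f : Vec d → X → ℝ) (S : Fin n → X) : Measurable (empGrad f S) := by
  have h : ∀ i, Measurable fun w => gradient (fun v => f v (S i)) w := fun i =>
    (InnerProductSpace.toDual ℝ (Vec d)).symm.continuous.measurable.comp (measurable_fderiv ℝ _)
  unfold empGrad
  fun_prop

variable (p : Params) {normEst : Vec d → A → ℝ} (f : Vec d → X → ℝ) (S : Fin n → X)

theorem measurable_gradScale : Measurable (p.gradScale n d) := by
  unfold Params.gradScale
  fun_prop

theorem measurable_budget : Measurable (p.budget n d) := by
  unfold Params.budget
  refine Measurable.add_const (Measurable.ite (measurableSet_singleton 0) measurable_const ?_) _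
  fun_prop

theorem measurable_gradStep :
    Measurable fun x : Vec d × Vec d × ℝ × Vec d =>
      gradStep p n x.1 x.2.1 x.2.2.1 x.2.2.2 := by
  have := measurable_gradScale (n := n) (d := d) p
  unfold gradStep
  fun_prop

theorem measurable_iterate (hN : Measurable fun x : Vec d × A => normEst x.1 x.2)
    (t : ℕ) :
    Measurable fun x : Vec d × (ℕ → A × Vec d) => iterate p normEst f x.1 S x.2 t := by
  induction t with
  | zero => exact measurable_fst
  | succ t ih =>
    have hg := (measurable_empGrad f S).comp ih
    have h1 : Measurable fun x : Vec d × (ℕ → A × Vec d) => (x.2 t).1 := by fun_prop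
    have h2 : Measurable fun x : Vec d × (ℕ → A × Vec d) => (x.2 t).2 := by fun_prop
    exact (measurable_gradStep (n := n) p).comp
      (ih.prodMk (hg.prodMk ((hN.comp (hg.prodMk h1)).prodMk h2)))

theorem measurable_spent (hN : Measurable fun x : Vec d × A => normEst x.1 x.2)
    (t : ℕ) :
    Measurable fun x : Vec d × (ℕ → A × Vec d) => spent p normEst f x.1 S x.2 t := by
  refine Finset.measurable_sum _ fun j _ => (measurable_budget p).comp ?_
  have h1 : Measurable fun x : Vec d × (ℕ → A × Vec d) => (x.2 j).1 := by fun_prop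
  exact hN.comp (((measurable_empGrad f S).comp (measurable_iterate p f S hN j)).prodMk h1)

theorem measurable_trajectoryFrom {p : Params}
    (hN : Measurable fun x : Vec d × A => normEst x.1 x.2)
    (hn : 0 < n) (hρ : 0 < p.ρ)
    (hb : ∀ N, √p.ρ / n < p.budget n d N) :
    Measurable fun x : ℝ × Vec d × (ℕ → A × Vec d) =>
      trajectoryFrom p normEst f S x.1 x.2.1 x.2.2 := by
  refine Trajectory.measurable_ofSeq
    (fun t => (measurable_iterate p f S hN t).comp measurable_snd) ?_
  classical
  have h := fun x : ℝ × Vec d × (ℕ → A × Vec d) =>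
    exists_lt_spent normEst f S hn hρ hb x.1 x.2.1 x.2.2
  -- The loop always stops, so the infimum is a first hitting time.
  have h2 : (fun x : ℝ × Vec d × (ℕ → A × Vec d) =>
      sInf {T | x.1 < spent p normEst f x.2.1 S x.2.2 (T + 1)}) =
      fun x => Nat.find (h x) := by
    ext x
    exact Nat.sInf_def (h x)
  rw [h2]
  exact measurable_find _ fun T =>
    measurableSet_lt measurable_fst ((measurable_spent p f S hN (T + 1)).comp measurable_snd)

end Measurability

/-! ### Sensitivity of the gradient and cost of a gradient step -/

section Privacy

variable {X A : Type*} [MeasurableSpace A] {n d : ℕ}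

theorem norm_gradient_le_of_lipschitzWith {g : Vec d → ℝ} {L : ℝ≥0} (hg : LipschitzWith L g)
    (w : Vec d) : ‖gradient g w‖ ≤ L := by
  rw [gradient, LinearIsometryEquiv.norm_map]
  exact norm_fderiv_le_of_lipschitz ℝ hg

theorem norm_empGrad_sub_le {f : Vec d → X → ℝ} {L : ℝ≥0}
    (hf : ∀ x, LipschitzWith L fun w => f w x) {S S' : Fin n → X} (h : Neighbors S S')
    (w : Vec d) : ‖empGrad f S w - empGrad f S' w‖ ≤ 2 * L / n := by
  obtain ⟨i, hi⟩ := h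
  rw [empGrad, empGrad, ← smul_sub, ← Finset.sum_sub_distrib,
    Finset.sum_eq_single i (fun j _ hj => by rw [hi j hj, sub_self]) (by simp), norm_smul,
    Real.norm_of_nonneg (by positivity), one_div, inv_mul_eq_div]
  gcongr
  refine (norm_sub_le _ _).trans ?_
  rw [two_mul]
  exact add_le_add (norm_gradient_le_of_lipschitzWith (hf _) w)
    (norm_gradient_le_of_lipschitzWith (hf _) w)

theorem Params.gradScale_pos {p : Params} (hn : 0 < n) (hρ : 0 < p.ρ) (hlip : 0 < p.lip) (N : ℝ) :
    0 < p.gradScale n d N :=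
  lt_max_of_lt_right (by positivity)

/-- The two entries of the maximum defining σ_t yield the two entries of the minimum in ρ_t. At N =
0 only the second is needed. -/
theorem Params.sq_div_gradScale_le {p : Params} (hn : 0 < n) (hd : 0 < d) (hρ : 0 < p.ρ)
    (hlip : 0 < p.lip) (hlog : 0 < p.logTerm n) (N : ℝ) :
    (2 * p.lip / n) ^ 2 / p.gradScale n d N ^ 2 / 2 ≤ 2 * (p.budget n d N - √p.ρ / n) := by
  have hσ := p.gradScale_pos (d := d) hn hρ hlip N
  have hn' : (0 : ℝ) < n := by exact_mod_cast hn
  have hd' : (0 : ℝ) < d := by exact_mod_cast hd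
  have h1 : (2 * p.lip / n) ^ 2 / p.gradScale n d N ^ 2 / 2 ≤ p.ρ / 2 := by
    have h : (2 * p.lip / (n * √p.ρ)) ^ 2 ≤ p.gradScale n d N ^ 2 :=
      pow_le_pow_left₀ (by positivity) (le_max_right _ _) 2
    gcongr
    rw [div_le_iff₀ (by positivity)]
    refine le_trans (le_of_eq ?_) (mul_le_mul_of_nonneg_left h hρ.le)
    rw [div_pow, div_pow, mul_pow (n : ℝ), Real.sq_sqrt hρ.le]
    field_simp
  rw [Params.budget, add_sub_cancel_right]
  split_ifs with hN
  · linarith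
  rw [mul_min_of_nonneg _ _ (by norm_num)]
  refine le_min ?_ (by linarith)
  have hN' : 0 < |N| := abs_pos.2 hN
  have h : (|N| / √(d * p.logTerm n)) ^ 2 ≤ p.gradScale n d N ^ 2 :=
    pow_le_pow_left₀ (by positivity) (le_max_left _ _) 2
  rw [div_pow, Real.sq_sqrt (by positivity), sq_abs] at h
  calc (2 * p.lip / n) ^ 2 / p.gradScale n d N ^ 2 / 2
      ≤ (2 * p.lip / n) ^ 2 / (N ^ 2 / (d * p.logTerm n)) / 2 := by gcongr
    _ = _ := by field_simp

theorem dualBound_gradStep {α q : ℝ} (hα : α.HolderConjugate q) {p : Params} (hn : 0 < n)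
    (hd : 0 < d) (hρ : 0 < p.ρ) (hlip : 0 < p.lip) (hlog : 0 < p.logTerm n) (w : Vec d)
    {g g' : Vec d} (hg : ‖g - g'‖ ≤ 2 * p.lip / n) (N : ℝ) :
    DualBound α q (2 * (p.budget n d N - √p.ρ / n))
      ((stdGaussian (Vec d)).map (gradStep p n w g N))
      ((stdGaussian (Vec d)).map (gradStep p n w g' N)) := by
  have hσ := p.gradScale_pos (d := d) hn hρ hlip N
  set σ := p.gradScale n d N with hσdef
  have hm : ∀ g : Vec d, Measurable (gradStep p n w g N) := fun g => by
    unfold gradStep; fun_prop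
  have h := (dualBound_stdGaussian hα (σ⁻¹ • (g - g'))).map (hm g')
  rw [Measure.map_map (hm g') (by fun_prop)] at h
  -- Replacing g' by g amounts to translating the Gaussian sample by σ⁻¹(g - g').
  have h1 : gradStep p n w g' N ∘ (· + σ⁻¹ • (g - g')) = gradStep p n w g N := by
    ext z : 1
    simp only [Function.comp, gradStep, ← hσdef]
    rw [smul_add σ, smul_inv_smul₀ hσ.ne']
    congr 2
    abel
  rw [h1] at h
  refine h.mono hα.lt.le (le_trans ?_ (p.sq_div_gradScale_le hn hd hρ hlip hlog N))
  rw [norm_smul, norm_inv, Real.norm_of_nonneg hσ.le, inv_mul_eq_div, div_pow]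
  gcongr

/-! ### Expectations over the released sequence -/

/-- Law of the noise of one iteration, over all iterations. -/
abbrev noiseLaw (ν : Measure A) (d : ℕ) : Measure (ℕ → A × Vec d) :=
  Measure.infinitePi fun _ : ℕ => ν.prod (stdGaussian (Vec d))

/-- Expected value of `h` at the released sequence, from `w` with remaining budget `r`. -/
def value (p : Params) (normEst : Vec d → A → ℝ) (ν : Measure A) (f : Vec d → X → ℝ)
    (S : Fin n → X) (h : Trajectory d → ℝ≥0∞) (r : ℝ) (w : Vec d) : ℝ≥0∞ :=
  ∫⁻ ω, h (trajectoryFrom p normEst f S r w ω) ∂(noiseLaw ν d)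

/-- The expectation of `h` at the released sequence, conditionally on the first noisy norm `N`. -/
def valueGiven (p : Params) (normEst : Vec d → A → ℝ) (ν : Measure A) (f : Vec d → X → ℝ)
    (S : Fin n → X) (h : Trajectory d → ℝ≥0∞) (r : ℝ) (w : Vec d) (N : ℝ) : ℝ≥0∞ :=
  open Classical in
  if r < p.budget n d N then h (.ofSeq (fun _ => w) 0)
  else ∫⁻ z, value p normEst ν f S (h ∘ .cons w) (r - p.budget n d N)
    (gradStep p n w (empGrad f S w) N z) ∂(stdGaussian (Vec d))

variable {p : Params} {normEst : Vec d → A → ℝ} (ν : Measure A) [IsProbabilityMeasure ν]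
  (f : Vec d → X → ℝ) (S : Fin n → X) {h : Trajectory d → ℝ≥0∞}

theorem measurable_value (hN : Measurable fun x : Vec d × A => normEst x.1 x.2) (hn : 0 < n)
    (hρ : 0 < p.ρ) (hb : ∀ N, √p.ρ / n < p.budget n d N) (hh : Measurable h) :
    Measurable fun x : ℝ × Vec d => value p normEst ν f S h x.1 x.2 := by
  have h1 : Measurable fun x : (ℝ × Vec d) × (ℕ → A × Vec d) =>
      h (trajectoryFrom p normEst f S x.1.1 x.1.2 x.2) :=
    hh.comp ((measurable_trajectoryFrom f S hN hn hρ hb).comp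
      (measurable_fst.fst.prodMk (measurable_fst.snd.prodMk measurable_snd)))
  exact h1.lintegral_prod_right'

theorem measurable_valueGiven (hN : Measurable fun x : Vec d × A => normEst x.1 x.2) (hn : 0 < n)
    (hρ : 0 < p.ρ) (hb : ∀ N, √p.ρ / n < p.budget n d N) (hh : Measurable h) (r : ℝ) (w : Vec d) :
    Measurable (valueGiven p normEst ν f S h r w) := by
  unfold valueGiven
  refine Measurable.ite (measurableSet_lt measurable_const (measurable_budget p))
    measurable_const ?_
  have hm := measurable_budget (n := n) (d := d) p
  have hg : Measurable fun x : ℝ × Vec d => gradStep p n w (empGrad f S w) x.1 x.2 :=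
    (measurable_gradStep p).comp (measurable_const.prodMk (measurable_const.prodMk
      (measurable_fst.prodMk measurable_snd)))
  have h1 : Measurable fun x : ℝ × Vec d =>
      value p normEst ν f S (h ∘ .cons w) (r - p.budget n d x.1)
        (gradStep p n w (empGrad f S w) x.1 x.2) :=
    (measurable_value ν f S hN hn hρ hb (hh.comp (Trajectory.measurable_cons w))).comp
      ((measurable_const.sub (hm.comp measurable_fst)).prodMk hg)
  exact h1.lintegral_prod_right'

/-- Splitting off the first noise pair isolates the law of `N`, the only place where the norm noise
of the first iteration enters. -/
theorem value_eq_lintegral_valueGiven (hN : Measurable fun x : Vec d × A => normEst x.1 x.2)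
    (hn : 0 < n) (hρ : 0 < p.ρ) (hb : ∀ N, √p.ρ / n < p.budget n d N) (hh : Measurable h)
    (r : ℝ) (w : Vec d) :
    value p normEst ν f S h r w =
      ∫⁻ N, valueGiven p normEst ν f S h r w N ∂(ν.map (normEst (empGrad f S w))) := by
  have hmt : Measurable fun ω => h (trajectoryFrom p normEst f S r w ω) :=
    hh.comp ((measurable_trajectoryFrom f S hN hn hρ hb).comp
      (measurable_const.prodMk (measurable_const.prodMk measurable_id)))
  have hNw : Measurable (normEst (empGrad f S w)) :=
    hN.comp (measurable_const.prodMk measurable_id)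
  have hmt' : Measurable fun y : A × Vec d => ∫⁻ ω,
      h (trajectoryFrom p normEst f S r w (natCons y ω)) ∂(noiseLaw ν d) :=
    (hmt.comp measurable_natCons).lintegral_prod_right'
  rw [value, lintegral_infinitePi_natCons _ hmt, lintegral_prod _ hmt'.aemeasurable,
    lintegral_map (measurable_valueGiven ν f S hN hn hρ hb hh r w) hNw]
  refine lintegral_congr fun a => ?_
  rw [valueGiven]
  split_ifs with hr
  · simp_rw [trajectoryFrom_of_lt p normEst f S (ω := natCons (a, _) _) hr]
    simp
  · refine lintegral_congr fun z => ?_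
    rw [value]
    refine lintegral_congr fun ω => ?_
    rw [trajectoryFrom_natCons_of_le normEst f S hn hρ hb (not_lt.1 hr)]
    rfl

end Privacy

/-! ### Adaptive composition -/

section Privacy

variable {X A : Type*} [MeasurableSpace A] {n d : ℕ}
variable {p : Params} {normEst : Vec d → A → ℝ} {ν : Measure A} [IsProbabilityMeasure ν]
  {f : Vec d → X → ℝ} {S S' : Fin n → X}

theorem ENNReal.le_exp_mul_rpow_rpow {q ε : ℝ} (hq : q ≠ 0) (hε : 0 ≤ ε) (a : ℝ≥0∞) :
    a ≤ ENNReal.ofReal (Real.exp ε) * (a ^ q) ^ (1 / q) := by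
  rw [← ENNReal.rpow_mul, mul_one_div_cancel hq, ENNReal.rpow_one]
  exact le_mul_of_one_le_left zero_le (ENNReal.one_le_ofReal.2 (Real.one_le_exp hε))

theorem ENNReal.ofReal_exp_mul_ofReal_exp (x y : ℝ) (b : ℝ≥0∞) :
    ENNReal.ofReal (Real.exp x) * (ENNReal.ofReal (Real.exp y) * b) =
      ENNReal.ofReal (Real.exp (x + y)) * b := by
  rw [← mul_assoc, ← ENNReal.ofReal_mul (Real.exp_pos _).le, Real.exp_add]

/-- Each completed iteration uses more than √ρ/n of the budget, so `k` bounds the depth of the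
recursion. The test function `h` varies in the induction, since later points are tested by `h ∘
.cons w`. -/
theorem value_le {α q L : ℝ} (hα : α.HolderConjugate q)
    (hN : Measurable fun x : Vec d × A => normEst x.1 x.2) (hn : 0 < n) (hρ : 0 < p.ρ)
    (hb : ∀ N, √p.ρ / n < p.budget n d N)
    (hS : ∀ w, ‖empGrad f S w - empGrad f S' w‖ ≤ L)
    (hdual : ∀ g g' : Vec d, ‖g - g'‖ ≤ L →
      DualBound α q (2 * (√p.ρ / n)) (ν.map (normEst g)) (ν.map (normEst g')))
    (hstep : ∀ (w g g' : Vec d) (N : ℝ), ‖g - g'‖ ≤ L →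
      DualBound α q (2 * (p.budget n d N - √p.ρ / n))
        ((stdGaussian (Vec d)).map (gradStep p n w g N))
        ((stdGaussian (Vec d)).map (gradStep p n w g' N)))
    (k : ℕ) {r : ℝ} (hr : 0 ≤ r) (hrk : r < k * (√p.ρ / n)) {h : Trajectory d → ℝ≥0∞}
    (hh : Measurable h) (w : Vec d) :
    value p normEst ν f S h r w ≤ ENNReal.ofReal (Real.exp ((α - 1) * (2 * r))) *
      (value p normEst ν f S' (fun o => h o ^ q) r w) ^ (1 / q) := by
  have hα1 : 0 < α - 1 := sub_pos.2 hα.lt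
  have hq := hα.symm.pos
  induction k generalizing r h w with
  | zero => simp only [Nat.cast_zero, zero_mul] at hrk; linarith
  | succ k ih =>
  push_cast at hrk
  -- With at most √ρ/n left, both runs release just `w` whatever the noise, at no cost. Otherwise r
  -- - √ρ/n ≥ 0 remains after paying for the norm.
  rcases le_or_gt r (√p.ρ / n) with hrs | hrs
  · simp_rw [value, trajectoryFrom_of_lt p normEst f _ (hrs.trans_lt (hb _))]
    simp only [lintegral_const, measure_univ, mul_one]
    exact ENNReal.le_exp_mul_rpow_rpow hq.ne' (by positivity) _
  have hm := measurable_valueGiven ν f S' hN hn hρ hb (hh.pow_const q) r w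
  -- Here both runs have the same noisy norm; the cost of its differing laws is paid afterwards
  -- through `hdual`.
  have key : ∀ N, valueGiven p normEst ν f S h r w N ≤
      ENNReal.ofReal (Real.exp ((α - 1) * (2 * (r - √p.ρ / n)))) *
        (valueGiven p normEst ν f S' (fun o => h o ^ q) r w N) ^ (1 / q) := by
    intro N
    rw [valueGiven, valueGiven]
    split_ifs with hrN
    · refine ENNReal.le_exp_mul_rpow_rpow hq.ne' ?_ _
      have : 0 ≤ r - √p.ρ / n := by linarith
      positivity
    have hbN := hb N
    have h0 : 0 ≤ r - p.budget n d N := by linarith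
    have h1 : Measurable fun z : Vec d => value p normEst ν f S'
        (fun o => h (.cons w o) ^ q) (r - p.budget n d N) z :=
      (measurable_value ν f S' hN hn hρ hb ((hh.comp
        (Trajectory.measurable_cons w)).pow_const q)).comp (measurable_const.prodMk measurable_id)
    have hstep_meas : ∀ g : Vec d, Measurable (gradStep p n w g N) := fun g => by
      unfold gradStep; fun_prop
    refine (lintegral_mono fun z => ih h0 (by linarith)
      (hh.comp (Trajectory.measurable_cons w)) _).trans ?_
    -- The 1/q-th power is the test function because the q-th power in the dual bound undoes it. The
    -- costs 2(r - ρ_t) and 2(ρ_t - √ρ/n) then sum to 2(r - √ρ/n).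
    have h2 := hstep w _ _ N (hS w) _ (h1.pow_const (1 / q))
    rw [lintegral_map (h1.pow_const _) (hstep_meas _)] at h2
    simp_rw [← ENNReal.rpow_mul, one_div_mul_cancel hq.ne', ENNReal.rpow_one] at h2
    rw [lintegral_map h1 (hstep_meas _)] at h2
    refine (lintegral_const_mul _ ((h1.comp (hstep_meas _)).pow_const (1 / q))).trans_le ?_
    refine (mul_le_mul_right h2 _).trans (le_of_eq ?_)
    rw [ENNReal.ofReal_exp_mul_ofReal_exp]
    congr 3
    ring
  rw [value_eq_lintegral_valueGiven ν f S hN hn hρ hb hh,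
    value_eq_lintegral_valueGiven ν f S' hN hn hρ hb (hh.pow_const q)]
  refine (lintegral_mono key).trans ?_
  rw [lintegral_const_mul _ (hm.pow_const _)]
  have h2 := hdual _ _ (hS w) _ (hm.pow_const (1 / q))
  simp_rw [← ENNReal.rpow_mul, one_div_mul_cancel hq.ne', ENNReal.rpow_one] at h2
  refine (mul_le_mul_right h2 _).trans (le_of_eq ?_)
  rw [ENNReal.ofReal_exp_mul_ofReal_exp]
  congr 3
  ring

theorem isZCDP_outputLaw (hn : 0 < n) (hd : 0 < d) (hρ : 0 < p.ρ) (hlip : 0 < p.lip)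
    (hlog : 0 < p.logTerm n) {L : ℝ≥0} (hL : p.lip = L) (hf : ∀ x, LipschitzWith L fun w => f w x)
    (hN : Measurable fun x : Vec d × A => normEst x.1 x.2)
    (hdual : ∀ (α q : ℝ), α.HolderConjugate q → ∀ g g' : Vec d, ‖g - g'‖ ≤ 2 * p.lip / n →
      DualBound α q (2 * (√p.ρ / n)) (ν.map (normEst g)) (ν.map (normEst g')))
    (w₀ : Vec d) :
    IsZCDP p.ρ fun S : Fin n → X => outputLaw p normEst ν f w₀ S := by
  have hb := Params.lt_budget hn hd hρ hlip hlog
  have hm : ∀ S : Fin n → X, Measurable (output p normEst f w₀ S) := fun S =>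
    (measurable_trajectoryFrom f S hN hn hρ hb).comp
      ((measurable_const (a := p.ρ / 2)).prodMk
        ((measurable_const (a := w₀)).prodMk measurable_id))
  have hprob : ∀ S : Fin n → X, IsProbabilityMeasure (outputLaw p normEst ν f w₀ S) := fun S =>
    Measure.isProbabilityMeasure_map (hm S).aemeasurable
  refine ⟨hprob, fun S S' hS α hα => ?_⟩
  have := hprob S
  have := hprob S'
  have hc := Real.HolderConjugate.conjExponent hα
  refine DualBound.renyiDiv_le hc fun u hu => ?_
  simp only [outputLaw]
  rw [lintegral_map hu (hm S), lintegral_map (hu.pow_const _) (hm S')]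
  obtain ⟨k, hk⟩ := exists_nat_gt (p.ρ / 2 / (√p.ρ / n))
  rw [div_lt_iff₀ (by positivity)] at hk
  -- The output is the trajectory with initial budget ρ/2, so its cost is 2 · ρ/2 = ρ.
  have h := value_le hc hN hn hρ hb (fun w => hL ▸ norm_empGrad_sub_le hf hS w) (hdual α _ hc)
    (fun w g g' N hg => dualBound_gradStep hc hn hd hρ hlip hlog w hg N) k
    (half_pos hρ).le hk hu w₀
  rw [mul_div_cancel₀ _ (two_ne_zero' ℝ)] at h
  exact h

/-! ### Cost of the noisy norm in both variants -/

theorem Params.normScale_pos (hn : 0 < n) (hρ : 0 < p.ρ) (hlip : 0 < p.lip) :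
    0 < p.normScale n := by
  unfold Params.normScale
  positivity

theorem Params.sq_normScale (hρ : 0 < p.ρ) :
    p.normScale n ^ 2 = p.lip ^ 2 / (n * √p.ρ) := by
  have h : (p.ρ ^ (1 / 4 : ℝ)) ^ 2 = √p.ρ := by
    rw [← Real.rpow_natCast, ← Real.rpow_mul hρ.le, Real.sqrt_eq_rpow]
    norm_num
  rw [Params.normScale, div_pow, mul_pow, Real.sq_sqrt (by positivity), h]

/-- As σ̂² = L₀²/(n√ρ), a shift of size 2L₀/n costs (4L₀²/n²) · n√ρ/(2L₀²) = 2√ρ/n. -/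
theorem Params.sq_div_normScale_le (hn : 0 < n) (hρ : 0 < p.ρ) (hlip : 0 < p.lip) {x : ℝ}
    (hx : |x| ≤ 2 * p.lip / n) : ((p.normScale n)⁻¹ * x) ^ 2 / 2 ≤ 2 * (√p.ρ / n) := by
  have h : x ^ 2 ≤ (2 * p.lip / n) ^ 2 := by
    rw [← sq_abs]
    exact pow_le_pow_left₀ (abs_nonneg x) hx 2
  rw [mul_pow, inv_pow, Params.sq_normScale hρ, inv_div]
  calc (n * √p.ρ) / p.lip ^ 2 * x ^ 2 / 2
      ≤ (n * √p.ρ) / p.lip ^ 2 * (2 * p.lip / n) ^ 2 / 2 := by gcongr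
    _ = 2 * (√p.ρ / n) := by
      have : (n : ℝ) ≠ 0 := by positivity
      field_simp

theorem dualBound_scalarNorm {α q : ℝ} (hα : α.HolderConjugate q) (hn : 0 < n) (hρ : 0 < p.ρ)
    (hlip : 0 < p.lip) {g g' : Vec d} (hg : ‖g - g'‖ ≤ 2 * p.lip / n) :
    DualBound α q (2 * (√p.ρ / n))
      ((gaussianReal 0 1).map fun z => ‖g‖ + p.normScale n * z)
      ((gaussianReal 0 1).map fun z => ‖g'‖ + p.normScale n * z) := by
  have hσ := Params.normScale_pos hn hρ hlip
  have h := (dualBound_gaussianReal hα ((p.normScale n)⁻¹ * (‖g‖ - ‖g'‖))).map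
    (φ := fun z => ‖g'‖ + p.normScale n * z) (by fun_prop)
  rw [Measure.map_map (by fun_prop) (by fun_prop)] at h
  have h1 : (fun z => ‖g'‖ + p.normScale n * z) ∘ (· + (p.normScale n)⁻¹ * (‖g‖ - ‖g'‖)) =
      fun z => ‖g‖ + p.normScale n * z := by
    ext z
    simp only [Function.comp]
    field_simp
    ring
  rw [h1] at h
  exact h.mono hα.lt.le (Params.sq_div_normScale_le hn hρ hlip
    ((abs_norm_sub_norm_le g g').trans hg))

/-- The noisy norm is a function of the noisy vector, whose cost is that of a Gaussian translation;
taking norms is post-processing. -/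
theorem dualBound_vectorNorm {α q : ℝ} (hα : α.HolderConjugate q) (hn : 0 < n) (hρ : 0 < p.ρ)
    (hlip : 0 < p.lip) {g g' : Vec d} (hg : ‖g - g'‖ ≤ 2 * p.lip / n) :
    DualBound α q (2 * (√p.ρ / n))
      ((stdGaussian (Vec d)).map fun z => ‖g + p.normScale n • z‖)
      ((stdGaussian (Vec d)).map fun z => ‖g' + p.normScale n • z‖) := by
  have hσ := Params.normScale_pos hn hρ hlip
  have h := (dualBound_stdGaussian hα ((p.normScale n)⁻¹ • (g - g'))).map
    (φ := fun z => ‖g' + p.normScale n • z‖) (by fun_prop)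
  rw [Measure.map_map (by fun_prop) (by fun_prop)] at h
  have h1 : (fun z => ‖g' + p.normScale n • z‖) ∘ (· + (p.normScale n)⁻¹ • (g - g')) =
      fun z => ‖g + p.normScale n • z‖ := by
    ext z
    simp only [Function.comp]
    rw [smul_add, smul_inv_smul₀ hσ.ne']
    congr 1
    abel
  rw [h1, norm_smul, Real.norm_of_nonneg (inv_pos.2 hσ).le] at h
  exact h.mono hα.lt.le (Params.sq_div_normScale_le hn hρ hlip (by rwa [abs_norm]))

end Privacy

end PrivateGD

end

theorem mainTheorem6 {X : Type*} (n d : ℕ) (hd : 0 < d) (ρ β : ℝ) (hρ : 0 < ρ) (hβ : 0 < β)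
    (hnβ : β < n * √ρ) (L₀ : ℝ≥0) (hL₀ : 0 < L₀) (L₁ : ℝ) (hL₁ : 0 < L₁)
    (f : EuclideanSpace ℝ (Fin d) → X → ℝ) (hf : ∀ x, LipschitzWith L₀ fun w => f w x)
    (w₀ : EuclideanSpace ℝ (Fin d)) :
    PrivateGD.IsZCDP ρ
        (fun S : Fin n → X => PrivateGD.adaptiveGDScalar ⟨ρ, β, L₀, L₁⟩ f w₀ S) ∧
      PrivateGD.IsZCDP ρ
        (fun S : Fin n → X => PrivateGD.adaptiveGDVector ⟨ρ, β, L₀, L₁⟩ f w₀ S) := by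
  -- For n = 0 the bound on β would read β < 0.
  have hn : 0 < n := by
    rcases Nat.eq_zero_or_pos n with rfl | h
    · simp only [Nat.cast_zero, zero_mul] at hnβ
      linarith
    · exact h
  have hlog : 0 < (⟨ρ, β, L₀, L₁⟩ : PrivateGD.Params).logTerm n :=
    Real.log_pos ((one_lt_div hβ).2 hnβ)
  have hlip : (0 : ℝ) < L₀ := hL₀
  exact ⟨PrivateGD.isZCDP_outputLaw hn hd hρ hlip hlog rfl hf (by fun_prop)
      (fun _ _ hα _ _ hg => PrivateGD.dualBound_scalarNorm hα hn hρ hlip hg) w₀,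
    PrivateGD.isZCDP_outputLaw hn hd hρ hlip hlog rfl hf (by fun_prop)
      (fun _ _ hα _ _ hg => PrivateGD.dualBound_vectorNorm hα hn hρ hlip hg) w₀⟩
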